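/- Let $E$ be a locally compact complete separable metric space in which every bounded set is relatively compact, and let $\mu$ be a $\sigma$-finite Borel measure on $E$. Let $\mathrm{Conf}(E)$ be the space of configurations on $E$ (collections of points, possibly with multiplicities, only finitely many of which lie in any bounded set), with the $\sigma$-algebra generated by the maps $X\mapsto \#_B(X)$ counting the points of $X$ in $B$, for $B\subset E$ bounded Borel. For a metric space $S$ let $\mathcal M_{\mathrm{fin}}(S)$ be the space of finite Borel measures on $S$ with the weak topology (defined by bounded continuous functions); $\mathcal M_{\mathrm{fin}}(\mathcal M_{\mathrm{fin}}(E))$ is the space of finite Borel measures on $\mathcal M_{\mathrm{fin}}(E)$, again with its weak topology. A bounded operator $K$ on the complex space $L_2(E,\mu)$ is locally trace class, $K\in\mathscr I_{1,\mathrm{loc}}(E,\mu)$, if $\chi_B K\chi_B$ is trace class for every bounded Borel set $B$. A probability measure $\mathbb P_K$ on $\mathrm{Conf}(E)$ is the determinantal measure induced by $K$ if for every bounded Borel function $g:E\to\mathbb C$ such that $g-1$ vanishes outside a bounded Borel set $B$, the function $\Psi_g(X)=\prod_{x\in X}g(x)$ is $\mathbb P_K$-integrable and $\mathbb E_{\mathbb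 P_K}\Psi_g=\det(1+(g-1)K\chi_B)$ (Fredholm determinant). Let $f$ be a bounded nonnegative continuous function on $E$; put $\mathrm{Conf}_f(E)=\{X\in\mathrm{Conf}(E):\sum_{x\in X}f(x)<\infty\}$ and $\sigma_f:\mathrm{Conf}_f(E)\to\mathcal M_{\mathrm{fin}}(E)$, $\sigma_f(X)=\sum_{x\in X}f(x)\,\delta_x$. Let $K_\alpha\in\mathscr I_{1,\mathrm{loc}}(E,\mu)$ be a family of self-adjoint positive contractions, with induced determinantal measures $\mathbb P_{K_\alpha}$, such that $$\sup_\alpha \operatorname{tr}\sqrt f K_\alpha\sqrt f<+\infty$$ and such that for every $\varepsilon>0$ there is a bounded Borel set $B_\varepsilon\subset E$ with $$\sup_\alpha\operatorname{tr}\chi_{E\setminus B_\varepsilon}\sqrt f K_\alpha\sqrt f\,\chi_{E\setminus B_\varepsilon}<\varepsilon.$$ Then $\mathbb P_{K_\alpha}(\mathrm{Conf}_f(E))=1$ for every $\alpha$, the push-forwards $(\sigma_f)_*\mathbb P_{K_\alpha}$ are well-defined Borel probability measures on $\mathcal M_{\mathrm{fin}}(E)$, and the family $\{(\sigma_f)_*\mathbb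 P_{K_\alpha}\}$ is weakly precompact (has compact closure) in $\mathcal M_{\mathrm{fin}}(\mathcal M_{\mathrm{fin}}(E))$. -/

import Mathlib

open MeasureTheory Set Filter Topology Bornology
open scoped ENNReal NNReal BoundedContinuousFunction

universe u
namespace DetProc

/-! ### The Borel structure of the space of finite measures

Mathlib equips `FiniteMeasure E` with the weak topology and with the sigma-algebra generated by
the evaluations `η ↦ η A`. Over a second countable metrizable space the latter is the Borel
sigma-algebra of the former, so that `FiniteMeasure (FiniteMeasure E)` is the space of finite
Borel measures on the space of finite measures, again with its weak topology. -/

section BorelFiniteMeasure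

/-- The elementary weakly open sets `{η | q < η G}` and `{η | η univ < q}`, where `q` is rational
and `G` is a finite union of members of `b`. -/
def subbasisFM {E : Type u} [MeasurableSpace E] (b : Set (Set E)) : Set (Set (FiniteMeasure E)) :=
  (fun p : Set (Set E) × ℚ =>
      {η : FiniteMeasure E | ENNReal.ofReal p.2 < (η : Measure E) (⋃₀ p.1)})
        '' ({s | s.Finite ∧ s ⊆ b} ×ˢ univ) ∪
    range (fun q : ℚ => {η : FiniteMeasure E | (η : Measure E) univ < ENNReal.ofReal q})

theorem measurable_evalFM {E : Type u} [MeasurableSpace E] {A : Set E} (hA : MeasurableSet A) :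
    Measurable (fun η : FiniteMeasure E => (η : Measure E) A) :=
  (Measure.measurable_coe hA).comp measurable_subtype_coe

theorem subbasisFM_countable {E : Type u} [MeasurableSpace E] {b : Set (Set E)}
    (hb : b.Countable) : (subbasisFM b).Countable :=
  (((Set.countable_ofPred_finite_subset hb).prod countable_univ).image _).union
    (countable_range _)

theorem subbasisFM_measurable {E : Type u} [MeasurableSpace E] {b : Set (Set E)}
    (hbc : b.Countable) (hb : ∀ s ∈ b, MeasurableSet s)
    {A : Set (FiniteMeasure E)} (hA : A ∈ subbasisFM b) : MeasurableSet A := by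
  rcases hA with ⟨⟨s, q⟩, ⟨⟨-, hs⟩, -⟩, rfl⟩ | ⟨q, rfl⟩
  · exact measurableSet_lt measurable_const
      (measurable_evalFM (MeasurableSet.sUnion (hbc.mono hs) fun t ht => hb t (hs ht)))
  · exact measurableSet_lt (measurable_evalFM MeasurableSet.univ) measurable_const

variable {E : Type u} [TopologicalSpace E] [MeasurableSpace E] [BorelSpace E]

theorem tendsto_of_subbasisFM [SecondCountableTopology E] {b : Set (Set E)}
    (hb : TopologicalSpace.IsTopologicalBasis b) (hbc : b.Countable)
    {x : ℕ → FiniteMeasure E} {y : FiniteMeasure E}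
    (h : ∀ A ∈ subbasisFM b, y ∈ A → ∀ᶠ n in atTop, x n ∈ A) : Tendsto x atTop (𝓝 y) := by
  have hlow : ∀ G : Set E, IsOpen G →
      (y : Measure E) G ≤ atTop.liminf (fun n => (x n : Measure E) G) := by
    intro G hG
    obtain ⟨S, hSb, rfl⟩ := hb.open_eq_sUnion hG
    have : Countable S := (hbc.mono hSb).to_subtype
    refine le_of_forall_lt fun c hc => ?_
    have hU : (⋃₀ S) = ⋃ t : Finset S, ⋃₀ (Subtype.val '' (t : Set S)) := by
      ext z
      simp only [mem_sUnion, mem_iUnion]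
      constructor
      · rintro ⟨s, hs, hz⟩
        exact ⟨{⟨s, hs⟩}, s, ⟨⟨s, hs⟩, by simp, rfl⟩, hz⟩
      · rintro ⟨t, s, ⟨s', -, rfl⟩, hz⟩
        exact ⟨s', s'.2, hz⟩
    have hdir : Directed (· ⊆ ·) (fun t : Finset S => ⋃₀ (Subtype.val '' (t : Set S))) := by
      classical
      intro t t'
      refine ⟨t ∪ t', ?_, ?_⟩ <;>
        exact sUnion_subset_sUnion (image_mono (by simp))
    rw [hU, hdir.measure_iUnion] at hc
    obtain ⟨t, ht⟩ := lt_iSup_iff.1 hc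
    obtain ⟨q, hq0, hcq, hqt⟩ := ENNReal.lt_iff_exists_rat_btwn.1 ht
    refine lt_of_lt_of_le hcq ?_
    refine le_liminf_of_le (by isBoundedDefault) ?_
    have := h {η : FiniteMeasure E | ENNReal.ofReal q <
        (η : Measure E) (⋃₀ (Subtype.val '' (t : Set S)))}
      (Or.inl ⟨(Subtype.val '' (t : Set S), q), ⟨⟨t.finite_toSet.image _, ?_⟩, trivial⟩, rfl⟩) hqt
    · filter_upwards [this] with n hn
      refine le_trans (le_of_lt hn) (measure_mono ?_)
      rintro z ⟨s, ⟨s', -, rfl⟩, hz⟩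
      exact ⟨s', s'.2, hz⟩
    · rintro _ ⟨s', -, rfl⟩
      exact hSb s'.2
  have hint : ∀ f : E →ᵇ ℝ, (∀ z, 0 ≤ f z) → ∀ ε > (0 : ℝ),
      ∀ᶠ n in atTop, ∫ z, f z ∂(y : Measure E) - ε < ∫ z, f z ∂(x n : Measure E) := by
    intro f hf ε hε
    have h1 := lintegral_le_liminf_lintegral_of_forall_isOpen_measure_le_liminf_measure
      (μ := (y : Measure E)) (μs := fun n => (x n : Measure E)) f.continuous hf hlow
    have key : ∀ η : FiniteMeasure E,
        ∫⁻ z, ENNReal.ofReal (f z) ∂(η : Measure E) = ENNReal.ofReal (∫ z, f z ∂(η : Measure E)) :=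
      fun η => (ofReal_integral_eq_lintegral_ofReal (f.integrable _) (ae_of_all _ hf)).symm
    simp only [key] at h1
    rcases lt_or_ge (∫ z, f z ∂(y : Measure E) - ε) 0 with h0 | h0
    · exact Eventually.of_forall fun n => h0.trans_le (integral_nonneg hf)
    have h2 : ENNReal.ofReal (∫ z, f z ∂(y : Measure E) - ε) <
        atTop.liminf (fun n => ENNReal.ofReal (∫ z, f z ∂(x n : Measure E))) :=
      lt_of_lt_of_le ((ENNReal.ofReal_lt_ofReal_iff (by linarith)).2 (by linarith)) h1
    filter_upwards [eventually_lt_of_lt_liminf h2] with n hn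
    exact (ENNReal.ofReal_lt_ofReal_iff_of_nonneg h0).1 hn
  have hmass : ∀ ε > (0 : ℝ), ∀ᶠ n in atTop,
      (x n : Measure E).real univ < (y : Measure E).real univ + ε := by
    intro ε hε
    obtain ⟨q, hq1, hq2⟩ := exists_rat_btwn
      (show (y : Measure E).real univ < (y : Measure E).real univ + ε by linarith)
    have := h {η : FiniteMeasure E | (η : Measure E) univ < ENNReal.ofReal q} (Or.inr ⟨q, rfl⟩)
      ((ENNReal.lt_ofReal_iff_toReal_lt (measure_ne_top _ _)).2 hq1)
    filter_upwards [this] with n hn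
    exact lt_trans ((ENNReal.lt_ofReal_iff_toReal_lt (measure_ne_top _ _)).1 hn) hq2
  have hmass' : ∀ ε > (0 : ℝ), ∀ᶠ n in atTop,
      (y : Measure E).real univ - ε < (x n : Measure E).real univ := by
    intro ε hε
    filter_upwards [hint (BoundedContinuousFunction.const E 1) (fun _ => by simp) ε hε] with n hn
    simpa using hn
  refine FiniteMeasure.tendsto_iff_forall_integral_tendsto.2 fun f => ?_
  rw [Metric.tendsto_atTop']
  intro ε hε
  have hC : 0 ≤ ‖f‖ := norm_nonneg f
  set δ : ℝ := ε / (2 * (‖f‖ + 1)) with hδ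
  have hδ0 : 0 < δ := by positivity
  have hδ1 : ‖f‖ * δ < ε / 2 := by
    rw [hδ]
    rw [← mul_div_assoc, div_lt_div_iff₀ (by positivity) (by positivity)]
    nlinarith
  have e1 := hint (BoundedContinuousFunction.const E ‖f‖ + f)
    (fun z => by have := neg_abs_le (f z); have := f.norm_coe_le_norm z; simp at *; linarith)
    (ε / 2) (by linarith)
  have e2 := hint (BoundedContinuousFunction.const E ‖f‖ - f)
    (fun z => by have := le_abs_self (f z); have := f.norm_coe_le_norm z; simp at *; linarith)
    (ε / 2) (by linarith)
  have i1 : ∀ η : FiniteMeasure E, ∫ z, (BoundedContinuousFunction.const E ‖f‖ + f) z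
      ∂(η : Measure E) = ‖f‖ * (η : Measure E).real univ + ∫ z, f z ∂(η : Measure E) := by
    intro η
    simp only [BoundedContinuousFunction.coe_add, Pi.add_apply,
      BoundedContinuousFunction.const_apply]
    rw [integral_add (integrable_const _) (f.integrable _)]
    simp [mul_comm]
  have i2 : ∀ η : FiniteMeasure E, ∫ z, (BoundedContinuousFunction.const E ‖f‖ - f) z
      ∂(η : Measure E) = ‖f‖ * (η : Measure E).real univ - ∫ z, f z ∂(η : Measure E) := by
    intro η
    simp only [BoundedContinuousFunction.coe_sub, Pi.sub_apply,
      BoundedContinuousFunction.const_apply]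
    rw [integral_sub (integrable_const _) (f.integrable _)]
    simp [mul_comm]
  simp only [i1] at e1
  simp only [i2] at e2
  obtain ⟨N, hN⟩ := eventually_atTop.1 ((e1.and e2).and ((hmass δ hδ0).and (hmass' δ hδ0)))
  refine ⟨N, fun n hn => ?_⟩
  obtain ⟨⟨h1, h2⟩, h3, h4⟩ := hN n hn.le
  rw [Real.dist_eq, abs_lt]
  constructor <;> nlinarith

theorem le_of_seqTendsto {X : Type u} (τ' τ : TopologicalSpace X)
    (hsc : @SecondCountableTopology X τ')
    (h : ∀ (x : ℕ → X) (y : X), Tendsto x atTop (@nhds X τ' y) → Tendsto x atTop (@nhds X τ y)) :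
    τ' ≤ τ := by
  have hs : @SequentialSpace X τ' := by
    let _ := τ'
    infer_instance
  rw [← continuous_id_iff_le]
  exact (@continuous_iff_seqContinuous X X τ' τ hs id).2 fun x y hxy => h x y hxy

/-- The sigma-algebra generated by the evaluations `η ↦ η A` on the space of finite measures is
the Borel sigma-algebra of the weak topology. -/
instance borelSpace_finiteMeasure {E : Type u} [TopologicalSpace E] [MeasurableSpace E]
    [BorelSpace E] [SecondCountableTopology E] [HasOuterApproxClosed E] :
    BorelSpace (FiniteMeasure E) := by
  obtain ⟨b, hbc, -, hb⟩ := TopologicalSpace.exists_countable_basis E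
  constructor
  apply le_antisymm
  · let m : MeasurableSpace (FiniteMeasure E) := borel (FiniteMeasure E)
    have hm : @BorelSpace (FiniteMeasure E) _ m := @BorelSpace.mk _ _ m rfl
    have hcoe : @Measurable (FiniteMeasure E) (Measure E) m _ (fun η => (η : Measure E)) := by
      have hclosed : ∀ F : Set E, IsClosed F →
          @Measurable _ _ m _ (fun η : FiniteMeasure E => (η : Measure E) F) := by
        intro F hF
        refine @measurable_of_tendsto_metrizable (FiniteMeasure E) ℝ≥0∞ m _ _ _ _
          (fun n η => ∫⁻ z, hF.apprSeq n z ∂(η : Measure E)) _ (fun n => ?_) ?_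
        · refine @Continuous.measurable _ _ _ m _ _ _ _ _ ?_
          exact continuous_iff_continuousAt.2 fun η =>
            FiniteMeasure.tendsto_iff_forall_lintegral_tendsto.1 tendsto_id (hF.apprSeq n)
        · rw [tendsto_pi_nhds]
          exact fun η => HasOuterApproxClosed.tendsto_lintegral_apprSeq hF (η : Measure E)
      refine @Measurable.measure_of_isPiSystem _ _ m _ _ _ {F | IsClosed F} ?_ isPiSystem_isClosed
        (fun F hF => hclosed F hF) (hclosed univ isClosed_univ)
      rw [BorelSpace.measurable_eq (α := E), borel_eq_generateFrom_isClosed]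
    exact hcoe.comap_le
  · let τ : TopologicalSpace (FiniteMeasure E) := TopologicalSpace.generateFrom (subbasisFM b)
    have hsc : @SecondCountableTopology (FiniteMeasure E) τ :=
      @SecondCountableTopology.mk _ τ ⟨subbasisFM b, subbasisFM_countable hbc, rfl⟩
    have hle : τ ≤ FiniteMeasure.instTopologicalSpace := by
      refine le_of_seqTendsto τ _ hsc fun x y hxy => ?_
      refine tendsto_of_subbasisFM hb hbc fun A hA hyA => ?_
      exact hxy (@IsOpen.mem_nhds _ τ _ _ (TopologicalSpace.isOpen_generateFrom_of_mem hA) hyA)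
    calc @borel _ FiniteMeasure.instTopologicalSpace ≤ @borel _ τ := borel_anti hle
      _ = MeasurableSpace.generateFrom (subbasisFM b) :=
        @borel_eq_generateFrom_of_subbasis _ _ τ hsc rfl
      _ ≤ _ := MeasurableSpace.generateFrom_le fun A hA =>
        subbasisFM_measurable hbc (fun s hs => (hb.isOpen hs).measurableSet) hA

end BorelFiniteMeasure

/-! ### Traces, trace class and Fredholm determinants on a complex Hilbert space -/

section Trace

variable {H : Type u} [NormedAddCommGroup H] [InnerProductSpace ℂ H]

theorem tsum_sq_inner {ι : Type u} (b : HilbertBasis ι ℂ H) (x : H) :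
    ∑' i, ENNReal.ofReal (‖inner ℂ (b i) x‖ ^ 2) = ENNReal.ofReal (‖x‖ ^ 2) := by
  have h := b.hasSum_inner_mul_inner x x
  have h2 : HasSum (fun i => ‖inner ℂ (b i) x‖ ^ 2) (‖x‖ ^ 2) := by
    have h3 := Complex.hasSum_re h
    convert h3 using 1
    · funext i
      rw [← inner_conj_symm x (b i), ← Complex.normSq_eq_conj_mul_self, Complex.ofReal_re,
        Complex.normSq_eq_norm_sq]
    · exact (inner_self_eq_norm_sq (𝕜 := ℂ) x).symm
  rw [← h2.tsum_eq, ENNReal.ofReal_tsum_of_nonneg (fun _ => by positivity) h2.summable]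

variable [CompleteSpace H]

/-- The sum `∑ i, ⟪b i, T (b i)⟫`, in `[0, ∞]`, over an orthonormal basis `b`, for a positive
operator `T`. -/
noncomputable def traceIn {ι : Type u} (b : HilbertBasis ι ℂ H) (T : H →L[ℂ] H) : ℝ≥0∞ :=
  ∑' i, ENNReal.ofReal (RCLike.re (inner ℂ (b i) (T (b i))))

/-- The trace, in `[0, ∞]`, of a positive operator `T`, computed in an arbitrarily chosen
orthonormal basis; it does not depend on the choice (`posTrace_eq`). -/
noncomputable def posTrace (T : H →L[ℂ] H) : ℝ≥0∞ :=
  traceIn (exists_hilbertBasis ℂ H).choose_spec.choose T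

theorem traceIn_adjoint_comp_self {ι κ : Type u} (b : HilbertBasis ι ℂ H)
    (c : HilbertBasis κ ℂ H) (S : H →L[ℂ] H) :
    traceIn b (ContinuousLinearMap.adjoint S ∘L S) =
      ∑' j, ENNReal.ofReal (‖ContinuousLinearMap.adjoint S (c j)‖ ^ 2) := by
  have h1 : ∀ i, ENNReal.ofReal (RCLike.re (inner ℂ (b i)
      ((ContinuousLinearMap.adjoint S ∘L S) (b i)))) =
      ∑' j, ENNReal.ofReal (‖inner ℂ (c j) (S (b i))‖ ^ 2) := by
    intro i
    rw [tsum_sq_inner c, ContinuousLinearMap.comp_apply, ContinuousLinearMap.adjoint_inner_right,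
      inner_self_eq_norm_sq]
  have h2 : ∀ j, ENNReal.ofReal (‖ContinuousLinearMap.adjoint S (c j)‖ ^ 2) =
      ∑' i, ENNReal.ofReal (‖inner ℂ (c j) (S (b i))‖ ^ 2) := by
    intro j
    rw [← tsum_sq_inner b]
    refine tsum_congr fun i => ?_
    rw [ContinuousLinearMap.adjoint_inner_right, norm_inner_symm]
  simp only [traceIn, h1, h2]
  exact ENNReal.tsum_comm

/-- The trace of a positive operator may be computed in any orthonormal basis. -/
theorem posTrace_eq {ι : Type u} (b : HilbertBasis ι ℂ H) {T : H →L[ℂ] H} (hT : T.IsPositive) :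
    posTrace T = traceIn b T := by
  have h0 : 0 ≤ T := (ContinuousLinearMap.nonneg_iff_isPositive T).2 hT
  have hS : ContinuousLinearMap.adjoint (CFC.sqrt T) ∘L CFC.sqrt T = T := by
    have h1 : ContinuousLinearMap.adjoint (CFC.sqrt T) = CFC.sqrt T :=
      (IsSelfAdjoint.of_nonneg (CFC.sqrt_nonneg T)).star_eq
    rw [h1]
    exact CFC.sqrt_mul_sqrt_self T h0
  rw [posTrace, ← hS, traceIn_adjoint_comp_self _ b, traceIn_adjoint_comp_self _ b]

/-- `T` is trace class: `|T| = √(T* T)` has finite trace. -/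
def IsTraceClass (T : H →L[ℂ] H) : Prop :=
  posTrace (CFC.abs T) < ∞

/-- The principal minor `det (⟪b i, T (b j)⟫)_{i, j ∈ s}` of `T` in the orthonormal basis `b`. -/
noncomputable def principalMinor {ι : Type u} (b : HilbertBasis ι ℂ H) (T : H →L[ℂ] H)
    (s : Finset ι) : ℂ :=
  open Classical in (Matrix.of fun i j : s => inner ℂ (b i) (T (b j))).det

/-- `d` is the Fredholm determinant `det (1 + T) = ∑ k, tr (Λᵏ T)`: in any orthonormal basis,
`tr (Λᵏ T)` is the sum of the principal minors of order `k` of `T`. The sum converges absolutely,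
to a value independent of the basis, for every trace class `T`. -/
def HasFredholmDet (T : H →L[ℂ] H) (d : ℂ) : Prop :=
  ∀ (ι : Type u) (b : HilbertBasis ι ℂ H), HasSum (principalMinor b T) d

end Trace

/-! ### Locally trace class operators on `L²(E, μ)` -/

section Operators

variable {E : Type u} [MeasurableSpace E] (μ : Measure E)

/-- Multiplication by an essentially bounded function `h` on `L²(E, μ)`
(the zero operator when `h` is not essentially bounded). -/
noncomputable def mulOp (h : E → ℂ) : Lp ℂ 2 μ →L[ℂ] Lp ℂ 2 μ :=
  open Classical in
  if hh : MemLp h ∞ μ then (ContinuousLinearMap.mul ℂ ℂ).holderL μ ∞ 2 2 (hh.toLp h) else 0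

theorem mulOp_apply {h : E → ℂ} (hh : MemLp h ∞ μ) (φ : Lp ℂ 2 μ) :
    mulOp μ h φ =ᵐ[μ] fun x => h x * φ x := by
  rw [mulOp, dif_pos hh, ContinuousLinearMap.holderL_apply_apply]
  filter_upwards [ContinuousLinearMap.coeFn_holder (r := 2) (ContinuousLinearMap.mul ℂ ℂ)
    (hh.toLp h) φ, hh.coeFn_toLp] with x hx hx'
  rw [hx, hx', ContinuousLinearMap.mul_apply']

/-- Multiplication by the characteristic function of `B`. -/
noncomputable def chi (B : Set E) : Lp ℂ 2 μ →L[ℂ] Lp ℂ 2 μ :=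
  mulOp μ (B.indicator fun _ => 1)

/-- Multiplication by `√f`. -/
noncomputable def mulSqrt (f : E → ℝ) : Lp ℂ 2 μ →L[ℂ] Lp ℂ 2 μ :=
  mulOp μ fun x => ((Real.sqrt (f x) : ℝ) : ℂ)

/-- `K` is locally of trace class: `χ_B K χ_B` is trace class for every bounded Borel set `B`. -/
def IsLocallyTraceClass [Bornology E] (K : Lp ℂ 2 μ →L[ℂ] Lp ℂ 2 μ) : Prop :=
  ∀ B : Set E, IsBounded B → MeasurableSet B → IsTraceClass (chi μ B ∘L K ∘L chi μ B)

end Operators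

/-! ### Configurations and determinantal measures -/

/-- A configuration on `E`: a collection of points of `E` with multiplicities, only finitely many
of which lie in any given bounded set. -/
structure Conf (E : Type u) [Bornology E] where
  /-- the multiplicity of a point -/
  mult : E → ℕ
  finite_inter : ∀ B : Set E, IsBounded B → (B ∩ Function.support mult).Finite

section Conf

variable {E : Type u} [Bornology E] [MeasurableSpace E]

/-- `#_B(X)`, the number of points of `X` in the bounded set `B`, with multiplicities. -/
noncomputable def Conf.count (B : Set E) (X : Conf E) : ℕ :=
  ∑ᶠ x ∈ B, X.mult x

/-- The sigma-algebra on configurations generated by the counting functions `#_B` of the bounded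
Borel sets `B`. -/
noncomputable instance instMeasurableSpaceConf : MeasurableSpace (Conf E) :=
  ⨆ (B : Set E) (_ : IsBounded B) (_ : MeasurableSet B), MeasurableSpace.comap (Conf.count B) ⊤

/-- The multiplicative functional `Ψ_g(X) = ∏_{x ∈ X} g(x)`; the product is finite
when `g = 1` outside a bounded set. -/
noncomputable def multFunctional (g : E → ℂ) (X : Conf E) : ℂ :=
  ∏ᶠ x, g x ^ X.mult x

/-- `P` is the determinantal measure induced by the operator `K`: for every bounded Borel `g` equal
to `1` outside a bounded Borel set `B`, the functional `Ψ_g` is integrable and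
`𝔼 Ψ_g = det (1 + (g - 1) K χ_B)`. -/
def IsDeterminantal (μ : Measure E) (K : Lp ℂ 2 μ →L[ℂ] Lp ℂ 2 μ)
    (P : ProbabilityMeasure (Conf E)) : Prop :=
  ∀ (g : E → ℂ) (B : Set E), Measurable g → (∃ C : ℝ, ∀ x, ‖g x‖ ≤ C) →
    IsBounded B → MeasurableSet B → (∀ x ∉ B, g x = 1) →
    Integrable (multFunctional g) (P : Measure (Conf E)) ∧
      HasFredholmDet (mulOp μ (fun x => g x - 1) ∘L K ∘L chi μ B)
        (∫ X, multFunctional g X ∂(P : Measure (Conf E)))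

/-! ### The coding of configurations by finite measures -/

/-- `Conf_f(E)`: the configurations `X` with `∑_{x ∈ X} f(x) < ∞`, for `f ≥ 0`. -/
def confF (f : E → ℝ) : Set (Conf E) :=
  {X | ∑' x, (X.mult x : ℝ≥0∞) * ENNReal.ofReal (f x) < ∞}

/-- The measure `∑_{x ∈ X} f(x) δ_x`. -/
noncomputable def weightedSum (f : E → ℝ) (X : Conf E) : Measure E :=
  Measure.sum fun x => ((X.mult x : ℝ≥0∞) * ENNReal.ofReal (f x)) • Measure.dirac x

theorem weightedSum_isFinite {f : E → ℝ} {X : Conf E} (hX : X ∈ confF f) :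
    IsFiniteMeasure (weightedSum f X) := by
  constructor
  rw [weightedSum, Measure.sum_apply _ MeasurableSet.univ]
  simpa [confF] using hX

/-- The map `σ_f(X) = ∑_{x ∈ X} f(x) δ_x` from `Conf_f(E)` to finite measures, extended by `0`
outside `Conf_f(E)`. -/
noncomputable def sigmaF (f : E → ℝ) (X : Conf E) : FiniteMeasure E :=
  open Classical in
  if hX : X ∈ confF f then ⟨weightedSum f X, weightedSum_isFinite hX⟩ else 0

end Conf

end DetProc

open DetProc

/-! The proof applies Prokhorov's criterion twice, first on `E` and then on `FiniteMeasure E`; both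
times the input is a first moment. For bounded B, testing the determinantal identity on g = 1 + t
χ_B gives E (1+t)^{#_B} = det(1 + t χ_B K χ_B). The difference quotient at t → 0+ tends to tr χ_B K
χ_B, while Bernoulli's inequality keeps it above #_B; hence E #_B ≤ tr χ_B K χ_B
(`lintegral_count_le_traceMeasure`). The trace is a measure in B, and integrating f against it gives
tr √f K √f (`posTrace_mulOp_comp`), so both hypotheses bound expected values of `weightedSum f X`:
its total mass, and its mass off a bounded set. Finite expectation gives `confF f` full probability.
By Markov, `sigmaF f X` lies in `boundedTailSet L n`, which is compact, except with probability at
most (M+2)2⁻ⁿ uniformly in the family (`measure_sigmaF_notMem_le`). This is tightness on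
`FiniteMeasure E`. -/

namespace DetProc

/-! ### The counting measure of a configuration -/

section PointMeasure

variable {E : Type u} [Bornology E]

theorem count_eq_sum {B : Set E} (hB : IsBounded B) (X : Conf E) :
    Conf.count B X = ∑ x ∈ (X.finite_inter B hB).toFinset, X.mult x := by
  rw [Conf.count]
  refine finsum_mem_eq_sum_of_inter_support_eq _ ?_
  ext x
  simp

/-- These are the only test functionals the proof uses: their expectations form the generating
function of #_B. -/
theorem multFunctional_eq_pow {B : Set E} (hB : IsBounded B) (c : ℂ) (X : Conf E) :
    multFunctional (fun x => 1 + B.indicator (fun _ => c) x) X = (1 + c) ^ Conf.count B X := by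
  rw [multFunctional, count_eq_sum hB, ← Finset.prod_pow_eq_pow_sum]
  rw [finprod_eq_prod_of_mulSupport_subset (s := (X.finite_inter B hB).toFinset)]
  · refine Finset.prod_congr rfl fun x hx => ?_
    have hxB : x ∈ B ∧ X.mult x ≠ 0 := by simpa using hx
    simp [hxB.1]
  · intro x hx
    rw [Function.mem_mulSupport] at hx
    simp only [Finite.coe_toFinset, mem_inter_iff, Function.mem_support]
    constructor
    · by_contra hxB
      simp [hxB] at hx
    · rintro h
      simp [h] at hx

variable [MeasurableSpace E]

/-- The measure `∑_{x ∈ X} δ_x`. -/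
noncomputable def pointMeasure (X : Conf E) : Measure E :=
  Measure.sum fun x => (X.mult x : ℝ≥0∞) • Measure.dirac x

theorem pointMeasure_apply {B : Set E} (hB : IsBounded B) (hBm : MeasurableSet B) (X : Conf E) :
    pointMeasure X B = Conf.count B X := by
  rw [pointMeasure, Measure.sum_apply _ hBm, count_eq_sum hB]
  have h : ∀ x ∉ (X.finite_inter B hB).toFinset,
      ((X.mult x : ℝ≥0∞) • Measure.dirac x) B = 0 := by
    intro x hx
    by_cases hxB : x ∈ B
    · have : X.mult x = 0 := by simpa [hxB] using hx
      simp [this]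
    · simp [Measure.dirac_apply' _ hBm, hxB]
  rw [tsum_eq_sum h, Nat.cast_sum]
  refine Finset.sum_congr rfl fun x hx => ?_
  have hxB : x ∈ B := by
    have : x ∈ B ∧ X.mult x ≠ 0 := by simpa using hx
    exact this.1
  simp [Measure.dirac_apply' _ hBm, hxB]

theorem measurable_count {B : Set E} (hB : IsBounded B) (hBm : MeasurableSet B) :
    Measurable (Conf.count B : Conf E → ℕ) := by
  refine measurable_iff_comap_le.2 ?_
  exact le_iSup_of_le B (le_iSup_of_le hB (le_iSup_of_le hBm le_rfl))

/-- Reduces measurability and expectations of `weightedSum f` to those of `pointMeasure`, which the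
counting functions control. -/
theorem weightedSum_eq_withDensity {f : E → ℝ} (hf : Measurable f) (X : Conf E) :
    weightedSum f X = (pointMeasure X).withDensity fun x => ENNReal.ofReal (f x) := by
  ext A hA
  rw [withDensity_apply _ hA, ← lintegral_indicator hA, pointMeasure, lintegral_sum_measure,
    weightedSum, Measure.sum_apply _ hA]
  refine tsum_congr fun x => ?_
  rw [lintegral_smul_measure, lintegral_dirac' _ (hf.ennreal_ofReal.indicator hA)]
  by_cases hx : x ∈ A <;> simp [Measure.dirac_apply' _ hA, hx]

theorem weightedSum_univ (f : E → ℝ) (X : Conf E) :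
    weightedSum f X univ = ∑' x, (X.mult x : ℝ≥0∞) * ENNReal.ofReal (f x) := by
  rw [weightedSum, Measure.sum_apply _ MeasurableSet.univ]
  simp

/-- The default value 0 off `confF f` only helps, so upper bounds on `weightedSum` transfer for
every X. -/
theorem sigmaF_apply_le (f : E → ℝ) (X : Conf E) (A : Set E) :
    (sigmaF f X : Measure E) A ≤ weightedSum f X A := by
  by_cases hX : X ∈ confF f
  · simp [sigmaF, hX]
  · simp [sigmaF, hX]

end PointMeasure

/-! ### Measurability of the coding map -/

section Measurability

variable {E : Type u} [MetricSpace E] [MeasurableSpace E] [BorelSpace E]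

/-- A measurable set is an increasing union of bounded measurable sets. -/
theorem exists_monotone_bounded_iUnion_eq {A : Set E} (hA : MeasurableSet A) :
    ∃ B : ℕ → Set E, Monotone B ∧ (∀ n, IsBounded (B n)) ∧ (∀ n, MeasurableSet (B n)) ∧
      ⋃ n, B n = A := by
  rcases isEmpty_or_nonempty E with hE | ⟨⟨x⟩⟩
  · exact ⟨fun _ => ∅, monotone_const, fun _ => isBounded_empty, fun _ => .empty,
      Subsingleton.elim _ _⟩
  · refine ⟨fun n => A ∩ Metric.closedBall x n, ?_, ?_, ?_, ?_⟩
    · intro n m h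
      exact inter_subset_inter_right _ (Metric.closedBall_subset_closedBall (by exact_mod_cast h))
    · exact fun n => Metric.isBounded_closedBall.subset inter_subset_right
    · exact fun n => hA.inter Metric.isClosed_closedBall.measurableSet
    · rw [← inter_iUnion, Metric.iUnion_closedBall_nat, inter_univ]

/-- Only counts of bounded sets are measurable by definition; other Borel sets are reached by
monotone limits. -/
theorem measurable_pointMeasure : Measurable (pointMeasure : Conf E → Measure E) := by
  refine Measure.measurable_of_measurable_coe _ fun A hA => ?_
  obtain ⟨B, hmono, hb, hm, rfl⟩ := exists_monotone_bounded_iUnion_eq hA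
  simp only [hmono.measure_iUnion]
  refine Measurable.iSup fun n => ?_
  simp only [pointMeasure_apply (hb n) (hm n)]
  exact (measurable_from_top (f := fun k : ℕ => (k : ℝ≥0∞))).comp (measurable_count (hb n) (hm n))

theorem measurable_weightedSum {f : E → ℝ} (hf : Measurable f) :
    Measurable (weightedSum f : Conf E → Measure E) := by
  refine Measure.measurable_of_measurable_coe _ fun A hA => ?_
  simp only [weightedSum_eq_withDensity hf, withDensity_apply _ hA, ← lintegral_indicator hA]
  exact (Measure.measurable_lintegral (hf.ennreal_ofReal.indicator hA)).comp
    measurable_pointMeasure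

theorem measurableSet_confF {f : E → ℝ} (hf : Measurable f) : MeasurableSet (confF f) := by
  have : (confF f : Set (Conf E)) = {X | weightedSum f X univ < ∞} := by
    ext X
    simp [confF, weightedSum_univ]
  rw [this]
  exact measurableSet_lt ((Measure.measurable_coe .univ).comp (measurable_weightedSum hf))
    measurable_const

theorem measurable_sigmaF {f : E → ℝ} (hf : Measurable f) :
    Measurable (sigmaF f : Conf E → FiniteMeasure E) := by
  classical
  have h : Measurable fun X : Conf E => if X ∈ confF f then weightedSum f X else 0 :=
    Measurable.ite (measurableSet_confF hf) (measurable_weightedSum hf) measurable_const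
  have h' : Measurable fun X : Conf E => (sigmaF f X : Measure E) := by
    convert h using 2 with X
    by_cases hX : X ∈ confF f <;> simp [sigmaF, hX]
  exact h'.subtype_mk (h := fun X => (sigmaF f X).2)

end Measurability

end DetProc

namespace DetProc

/-! ### The first order expansion of a Fredholm determinant -/

section Fredholm

variable {H : Type u} [NormedAddCommGroup H] [InnerProductSpace ℂ H]

theorem principalMinor_empty {ι : Type u} (b : HilbertBasis ι ℂ H) (T : H →L[ℂ] H) :
    principalMinor b T ∅ = 1 := by
  classical
  rw [principalMinor]
  have : IsEmpty (↥(∅ : Finset ι)) := ⟨fun x => Finset.notMem_empty _ x.2⟩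
  convert Matrix.det_isEmpty
  exact this

theorem principalMinor_singleton {ι : Type u} (b : HilbertBasis ι ℂ H) (T : H →L[ℂ] H) (i : ι) :
    principalMinor b T {i} = inner ℂ (b i) (T (b i)) := by
  classical
  rw [principalMinor]
  convert Matrix.det_unique _
  all_goals first | infer_instance | rfl

theorem principalMinor_smul {ι : Type u} (b : HilbertBasis ι ℂ H) (T : H →L[ℂ] H) (z : ℂ)
    (s : Finset ι) : principalMinor b (z • T) s = z ^ s.card * principalMinor b T s := by
  classical
  rw [principalMinor, principalMinor]
  have : (Matrix.of fun i j : s => inner ℂ (b i) ((z • T) (b j))) =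
      z • Matrix.of fun i j : s => inner ℂ (b i) (T (b j)) := by
    ext i j
    simp
  rw [this, Matrix.det_smul, Fintype.card_coe]

/-- The diagonal of `T` is summable, with sum the derivative of `t ↦ ∑ₛ det (t T)ₛ` at `0`. -/
theorem exists_hasSum_diagonal {ι : Type u} (b : HilbertBasis ι ℂ H) (T : H →L[ℂ] H) {d : ℝ → ℂ}
    (hd : ∀ t : ℝ, 0 < t → t ≤ 1 → HasSum (principalMinor b ((t : ℂ) • T)) (d t)) :
    ∃ L, HasSum (fun i => inner ℂ (b i) (T (b i))) L ∧
      Tendsto (fun t : ℝ => (d t - 1) / t) (𝓝[>] 0) (𝓝 L) := by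
  classical
  set F := principalMinor b T with hF
  -- The case t = 1 provides the dominating function for all 0 < t ≤ 1.
  have hF1 : Summable F := by simpa using (hd 1 one_pos le_rfl).summable
  -- `G t` is the termwise expansion of (d t - 1)/t: minors of tT scale as t^|s|, and the empty
  -- minor 1 is removed. At t = 0 only singletons survive, giving `G₀`.
  set G : ℝ → Finset ι → ℂ := fun t s => if s = ∅ then 0 else (t : ℂ) ^ (s.card - 1) * F s with hG
  set G₀ : Finset ι → ℂ := fun s => if s.card = 1 then F s else 0 with hG₀
  have hbound : ∀ s, ‖G₀ s‖ ≤ ‖F s‖ := fun s => by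
    simp only [hG₀]; split_ifs <;> simp
  have hlim : Tendsto (fun t : ℝ => ∑' s, G t s) (𝓝[>] 0) (𝓝 (∑' s, G₀ s)) := by
    refine tendsto_tsum_of_dominated_convergence hF1.norm (fun s => ?_) ?_
    · rcases eq_or_ne s ∅ with rfl | hs
      · simp [hG, hG₀]
      · simp only [hG, hG₀, if_neg hs]
        have hc : Continuous fun t : ℝ => (t : ℂ) ^ (s.card - 1) * F s := by fun_prop
        have h0 := (hc.tendsto 0).mono_left (nhdsWithin_le_nhds (s := Ioi 0))
        convert h0 using 2
        have hpos : 0 < s.card := Finset.card_pos.2 (Finset.nonempty_iff_ne_empty.2 hs)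
        split_ifs with h1
        · simp [h1]
        · have : s.card - 1 ≠ 0 := by omega
          simp [this]
    · filter_upwards [Ioc_mem_nhdsGT (zero_lt_one' ℝ)] with t ht s
      simp only [hG]
      split_ifs
      · simp
      · rw [norm_mul, norm_pow, Complex.norm_real, Real.norm_of_nonneg ht.1.le]
        exact mul_le_of_le_one_left (norm_nonneg _) (pow_le_one₀ ht.1.le ht.2)
  refine ⟨∑' s, G₀ s, ?_, hlim.congr' ?_⟩
  · have h0 : HasSum G₀ (∑' s, G₀ s) := (Summable.of_norm_bounded hF1.norm hbound).hasSum
    have hinj : Function.Injective (fun i : ι => ({i} : Finset ι)) := Finset.singleton_injective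
    rw [← hinj.hasSum_iff] at h0
    · convert h0 using 2 with i
      simp [hG₀, hF, principalMinor_singleton]
    · intro s hs
      simp only [hG₀]
      rw [if_neg]
      rw [Finset.card_eq_one]
      rintro ⟨i, rfl⟩
      exact hs ⟨i, rfl⟩
  · filter_upwards [Ioc_mem_nhdsGT (zero_lt_one' ℝ)] with t ht
    have ht0 : (t : ℂ) ≠ 0 := by exact_mod_cast ht.1.ne'
    have h1 := (hasSum_ite_sub_hasSum (hd t ht.1 ht.2) ∅).div_const (t : ℂ)
    rw [principalMinor_empty] at h1
    rw [← h1.tsum_eq]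
    refine tsum_congr fun s => ?_
    simp only [hG]
    split_ifs with hs
    · simp
    · have hpos : 0 < s.card := Finset.card_pos.2 (Finset.nonempty_iff_ne_empty.2 hs)
      rw [principalMinor_smul, eq_div_iff ht0]
      obtain ⟨k, hk⟩ : ∃ k, s.card = k + 1 := ⟨s.card - 1, by omega⟩
      rw [hk, Nat.add_sub_cancel]
      ring

variable [CompleteSpace H]

/-- The square root of a positive operator. -/
noncomputable def opSqrt (T : H →L[ℂ] H) : H →L[ℂ] H :=
  CFC.sqrt T

theorem adjoint_opSqrt (T : H →L[ℂ] H) :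
    ContinuousLinearMap.adjoint (opSqrt T) = opSqrt T :=
  (IsSelfAdjoint.of_nonneg (CFC.sqrt_nonneg T)).star_eq

theorem opSqrt_comp_opSqrt {T : H →L[ℂ] H} (hT : T.IsPositive) : opSqrt T ∘L opSqrt T = T :=
  CFC.sqrt_mul_sqrt_self T ((ContinuousLinearMap.nonneg_iff_isPositive T).2 hT)

end Fredholm

/-! ### Multiplication operators and the trace measure -/

section TraceMeasure

variable {E : Type u} [MeasurableSpace E] {μ : Measure E}

theorem memLp_top_of_bounded {h : E → ℂ} (hm : Measurable h) {C : ℝ} (hC : ∀ x, ‖h x‖ ≤ C) :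
    MemLp h ∞ μ :=
  memLp_top_of_bound hm.aestronglyMeasurable C (ae_of_all _ hC)

theorem mulOp_comp_mulOp {g h : E → ℂ} (hg : MemLp g ∞ μ) (hh : MemLp h ∞ μ)
    (hgh : MemLp (fun x => g x * h x) ∞ μ) :
    mulOp μ g ∘L mulOp μ h = mulOp μ fun x => g x * h x := by
  ext φ
  filter_upwards [mulOp_apply μ hg (mulOp μ h φ), mulOp_apply μ hh φ, mulOp_apply μ hgh φ]
    with x h1 h2 h3
  rw [h3, ContinuousLinearMap.comp_apply, h1, h2, mul_assoc]

theorem mulOp_const_mul {h : E → ℂ} (hh : MemLp h ∞ μ) (z : ℂ) :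
    mulOp μ (fun x => z * h x) = z • mulOp μ h := by
  ext φ
  filter_upwards [mulOp_apply μ hh φ, mulOp_apply μ (hh.const_mul z) φ,
    Lp.coeFn_smul z (mulOp μ h φ)] with x h1 h2 h3
  rw [_root_.smul_apply, h2, h3, Pi.smul_apply, h1, smul_eq_mul, mul_assoc]

theorem adjoint_mulOp_ofReal {c : E → ℝ} (hc : MemLp (fun x => (c x : ℂ)) ∞ μ) :
    ContinuousLinearMap.adjoint (mulOp μ fun x => (c x : ℂ)) = mulOp μ fun x => (c x : ℂ) := by
  refine ((ContinuousLinearMap.eq_adjoint_iff _ _).2 fun φ ψ => ?_).symm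
  rw [L2.inner_def, L2.inner_def]
  refine integral_congr_ae ?_
  filter_upwards [mulOp_apply μ hc φ, mulOp_apply μ hc ψ] with x h1 h2
  rw [h1, h2]
  simp [RCLike.inner_apply]
  ring

/-- The measure `B ↦ tr (χ_B K χ_B)` of a positive operator `K` on `L²(E, μ)`. -/
noncomputable def traceMeasure (K : Lp ℂ 2 μ →L[ℂ] Lp ℂ 2 μ) : Measure E :=
  Measure.sum fun j => μ.withDensity fun x =>
    ‖opSqrt K ((exists_hilbertBasis ℂ (Lp ℂ 2 μ)).choose_spec.choose j) x‖ₑ ^ 2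

theorem ofReal_norm_sq_eq_lintegral (φ : Lp ℂ 2 μ) :
    ENNReal.ofReal (‖φ‖ ^ 2) = ∫⁻ x, ‖φ x‖ₑ ^ 2 ∂μ := by
  rw [ENNReal.ofReal_pow (norm_nonneg _), ofReal_norm, Lp.enorm_def]
  have := eLpNorm_nnreal_pow_eq_lintegral (μ := μ) (f := φ) (p := 2) (by simp)
  simpa using this

/-- With S = √K and M multiplication by c, MKM = (SM)*(SM), and its trace equals Σ ‖(SM)* eⱼ‖² = Σ
‖M S eⱼ‖² = Σ ∫ c² |S eⱼ|² dμ. Passing to the adjoint puts M outermost, where it acts pointwise. -/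
theorem posTrace_mulOp_comp {K : Lp ℂ 2 μ →L[ℂ] Lp ℂ 2 μ} (hK : K.IsPositive) {c : E → ℝ}
    (hc : Measurable c) (hc' : MemLp (fun x => (c x : ℂ)) ∞ μ) :
    posTrace (mulOp μ (fun x => (c x : ℂ)) ∘L K ∘L mulOp μ (fun x => (c x : ℂ))) =
      ∫⁻ x, ENNReal.ofReal (c x ^ 2) ∂(traceMeasure K) := by
  set S := opSqrt K with hS
  set M := mulOp μ (fun x => (c x : ℂ)) with hM
  have hSa : ContinuousLinearMap.adjoint S = S := adjoint_opSqrt K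
  have hSS : S ∘L S = K := opSqrt_comp_opSqrt hK
  have hadj : ContinuousLinearMap.adjoint (S ∘L M) = M ∘L S := by
    rw [ContinuousLinearMap.adjoint_comp, hSa, adjoint_mulOp_ofReal hc']
  have hT : M ∘L K ∘L M = ContinuousLinearMap.adjoint (S ∘L M) ∘L (S ∘L M) := by
    rw [hadj, ← hSS]
    rfl
  rw [posTrace, hT, traceIn_adjoint_comp_self _ (exists_hilbertBasis ℂ (Lp ℂ 2 μ)).choose_spec.choose,
    traceMeasure, lintegral_sum_measure, hadj]
  refine tsum_congr fun j => ?_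
  rw [ofReal_norm_sq_eq_lintegral, lintegral_withDensity_eq_lintegral_mul₀]
  · refine lintegral_congr_ae ?_
    filter_upwards [mulOp_apply μ hc' (S ((exists_hilbertBasis ℂ (Lp ℂ 2 μ)).choose_spec.choose j))]
      with x hx
    rw [ContinuousLinearMap.comp_apply, hx, Pi.mul_apply, enorm_mul, mul_pow, mul_comm]
    congr 1
    rw [← sq_abs, ENNReal.ofReal_pow (abs_nonneg _), ← Real.norm_eq_abs, ← Complex.norm_real,
      ofReal_norm]
  · exact (Lp.aestronglyMeasurable _).enorm.pow_const 2
  · exact (hc.pow_const 2).ennreal_ofReal.aemeasurable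

theorem memLp_indicator_one {B : Set E} (hB : MeasurableSet B) :
    MemLp (B.indicator fun _ => (1 : ℂ)) ∞ μ :=
  memLp_top_of_bounded (measurable_const.indicator hB) (C := 1) fun x => by
    by_cases hx : x ∈ B <;> simp [hx]

theorem posTrace_chi_comp {K : Lp ℂ 2 μ →L[ℂ] Lp ℂ 2 μ} (hK : K.IsPositive) {B : Set E}
    (hB : MeasurableSet B) : posTrace (chi μ B ∘L K ∘L chi μ B) = traceMeasure K B := by
  have h : (B.indicator fun _ => (1 : ℂ)) = fun x => ((B.indicator (fun _ => (1 : ℝ)) x : ℝ) : ℂ) := by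
    ext x
    by_cases hx : x ∈ B <;> simp [hx]
  have hm := memLp_indicator_one (μ := μ) hB
  rw [h] at hm
  rw [chi, h, posTrace_mulOp_comp hK (measurable_const.indicator hB) hm, ← lintegral_indicator_one hB]
  refine lintegral_congr fun x => ?_
  by_cases hx : x ∈ B <;> simp [hx]

theorem isPositive_chi_comp {K : Lp ℂ 2 μ →L[ℂ] Lp ℂ 2 μ} (hK : K.IsPositive) {B : Set E}
    (hB : MeasurableSet B) : (chi μ B ∘L K ∘L chi μ B).IsPositive := by
  have h : (B.indicator fun _ => (1 : ℂ)) = fun x => ((B.indicator (fun _ => (1 : ℝ)) x : ℝ) : ℂ) := by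
    ext x
    by_cases hx : x ∈ B <;> simp [hx]
  have hm := memLp_indicator_one (μ := μ) hB
  rw [h] at hm
  have hadj : ContinuousLinearMap.adjoint (chi μ B) = chi μ B := by
    rw [chi, h, adjoint_mulOp_ofReal hm]
  simpa [hadj] using hK.conj_adjoint (chi μ B)

/-- Each outer pair of factors is multiplication by 1_A √f, whose square is 1_A f. -/
theorem posTrace_chi_mulSqrt (hK : K.IsPositive) {f : E → ℝ} (hf : Measurable f)
    (hf0 : ∀ x, 0 ≤ f x) {C : ℝ} (hC : ∀ x, f x ≤ C) {A : Set E} (hA : MeasurableSet A) :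
    posTrace (chi μ A ∘L mulSqrt μ f ∘L K ∘L mulSqrt μ f ∘L chi μ A) =
      ∫⁻ x in A, ENNReal.ofReal (f x) ∂(traceMeasure K) := by
  set c : E → ℝ := A.indicator fun x => √(f x) with hc
  have hcm : Measurable c := hf.sqrt.indicator hA
  -- Boundedness keeps `mulOp` away from its default value 0.
  have hbd : ∀ x, ‖((√(f x) : ℝ) : ℂ)‖ ≤ √C := fun x => by
    rw [Complex.norm_real, Real.norm_of_nonneg (Real.sqrt_nonneg _)]
    exact Real.sqrt_le_sqrt (hC x)
  have hsq : MemLp (fun x => ((√(f x) : ℝ) : ℂ)) ∞ μ :=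
    memLp_top_of_bounded (Complex.measurable_ofReal.comp hf.sqrt) hbd
  have hcL : MemLp (fun x => (c x : ℂ)) ∞ μ :=
    memLp_top_of_bounded (Complex.measurable_ofReal.comp hcm) (C := √C) fun x => by
      by_cases hx : x ∈ A
      · simpa only [hc, indicator_of_mem hx] using hbd x
      · simp [hc, hx, Real.sqrt_nonneg]
  have e1 : (fun x => A.indicator (fun _ => (1 : ℂ)) x * ((√(f x) : ℝ) : ℂ)) =
      fun x => (c x : ℂ) := by
    ext x
    by_cases hx : x ∈ A <;> simp [hc, hx]
  have e2 : (fun x => ((√(f x) : ℝ) : ℂ) * A.indicator (fun _ => (1 : ℂ)) x) =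
      fun x => (c x : ℂ) := by
    ext x
    by_cases hx : x ∈ A <;> simp [hc, hx]
  have h1 : chi μ A ∘L mulSqrt μ f = mulOp μ fun x => (c x : ℂ) := by
    rw [chi, mulSqrt, mulOp_comp_mulOp (memLp_indicator_one hA) hsq (by rwa [e1]), e1]
  have h2 : mulSqrt μ f ∘L chi μ A = mulOp μ fun x => (c x : ℂ) := by
    rw [chi, mulSqrt, mulOp_comp_mulOp hsq (memLp_indicator_one hA) (by rwa [e2]), e2]
  rw [h2, ← ContinuousLinearMap.comp_assoc, h1, posTrace_mulOp_comp hK hcm hcL,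
    ← lintegral_indicator hA]
  refine lintegral_congr fun x => ?_
  by_cases hx : x ∈ A <;> simp [hc, hx, Real.sq_sqrt (hf0 x)]

theorem posTrace_mulSqrt (hK : K.IsPositive) {f : E → ℝ} (hf : Measurable f)
    (hf0 : ∀ x, 0 ≤ f x) {C : ℝ} (hC : ∀ x, f x ≤ C) :
    posTrace (mulSqrt μ f ∘L K ∘L mulSqrt μ f) =
      ∫⁻ x, ENNReal.ofReal (f x) ∂(traceMeasure K) := by
  have hsq : MemLp (fun x => ((√(f x) : ℝ) : ℂ)) ∞ μ :=
    memLp_top_of_bounded (Complex.measurable_ofReal.comp hf.sqrt) (C := √C) fun x => by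
      rw [Complex.norm_real, Real.norm_of_nonneg (Real.sqrt_nonneg _)]
      exact Real.sqrt_le_sqrt (hC x)
  rw [mulSqrt, posTrace_mulOp_comp hK hf.sqrt hsq]
  simp only [Real.sq_sqrt (hf0 _)]

end TraceMeasure

end DetProc

namespace DetProc

/-! ### The intensity of a determinantal measure -/

section Intensity

variable {E : Type u} [MetricSpace E] [MeasurableSpace E] {μ : Measure E}
  {K : Lp ℂ 2 μ →L[ℂ] Lp ℂ 2 μ} {P : ProbabilityMeasure (Conf E)}

/-- An inequality suffices for tightness, and Bernoulli's inequality yields it with no limit taken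
under the expectation. -/
theorem lintegral_count_le_traceMeasure (hK : K.IsPositive) (hP : IsDeterminantal μ K P)
    {B : Set E} (hB : IsBounded B) (hBm : MeasurableSet B) :
    ∫⁻ X, (Conf.count B X : ℝ≥0∞) ∂(P : Measure (Conf E)) ≤ traceMeasure K B := by
  set T := chi μ B ∘L K ∘L chi μ B with hT
  -- The basis chosen in `posTrace`, so that the trace unfolds without a change of basis.
  set b := (exists_hilbertBasis ℂ (Lp ℂ 2 μ)).choose_spec.choose with hb
  set d : ℝ → ℂ := fun t => ∫ X, ((1 : ℂ) + t) ^ Conf.count B X ∂(P : Measure (Conf E)) with hd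
  have key : ∀ t : ℝ, 0 < t → t ≤ 1 →
      Integrable (fun X => ((1 : ℂ) + t) ^ Conf.count B X) (P : Measure (Conf E)) ∧
        HasSum (principalMinor b ((t : ℂ) • T)) (d t) := by
    intro t ht0 ht1
    have h := hP (fun x => 1 + B.indicator (fun _ => (t : ℂ)) x) B
      (measurable_const.add (measurable_const.indicator hBm)) ⟨1 + ‖(t : ℂ)‖, fun x => ?_⟩ hB hBm
      (fun x hx => by simp [hx])
    · have hΨ : multFunctional (fun x => 1 + B.indicator (fun _ => (t : ℂ)) x) =
          fun X => ((1 : ℂ) + t) ^ Conf.count B X := funext fun X => multFunctional_eq_pow hB _ X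
      have hop : mulOp μ (fun x => (1 : ℂ) + B.indicator (fun _ => (t : ℂ)) x - 1) =
          (t : ℂ) • chi μ B := by
        rw [chi, ← mulOp_const_mul (memLp_indicator_one hBm)]
        congr 1
        ext x
        by_cases hx : x ∈ B <;> simp [hx]
      rw [hΨ, hop, ContinuousLinearMap.smul_comp] at h
      exact ⟨h.1, h.2 _ b⟩
    · by_cases hx : x ∈ B
      · simpa [hx] using norm_add_le (1 : ℂ) (t : ℂ)
      · simp [hx]
  obtain ⟨L, hL, hlim⟩ := exists_hasSum_diagonal b T fun t h0 h1 => (key t h0 h1).2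
  -- Positivity of T makes the diagonal nonnegative, so its complex sum L agrees with the trace in
  -- [0, ∞].
  have htrace : traceMeasure K B = ENNReal.ofReal L.re := by
    rw [← posTrace_chi_comp hK hBm, posTrace, traceIn]
    have hre : HasSum (fun i => (inner ℂ (b i) (T (b i))).re) L.re := Complex.hasSum_re hL
    rw [← hre.tsum_eq, ENNReal.ofReal_tsum_of_nonneg _ hre.summable]
    · rfl
    · exact fun i => (isPositive_chi_comp hK hBm).re_inner_nonneg_right (b i)
  have hre := (Complex.continuous_re.tendsto L).comp hlim
  rw [htrace]
  refine ge_of_tendsto (ENNReal.tendsto_ofReal hre) ?_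
  filter_upwards [Ioc_mem_nhdsGT (zero_lt_one' ℝ)] with t ht
  have hint := (key t ht.1 ht.2).1
  have hcast : ∀ X : Conf E, ((1 : ℂ) + t) ^ Conf.count B X =
      (((1 + t) ^ Conf.count B X : ℝ) : ℂ) := fun X => by push_cast; rfl
  have hintR : Integrable (fun X => (1 + t) ^ Conf.count B X) (P : Measure (Conf E)) := by
    simp only [hcast] at hint
    exact hint.re
  have hdt : ((d t - 1) / t).re =
      ∫ X, ((1 + t) ^ Conf.count B X - 1) / t ∂(P : Measure (Conf E)) := by
    rw [integral_div, integral_sub hintR (integrable_const _)]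
    simp only [hd, hcast]
    rw [integral_complex_ofReal]
    simp [← Complex.ofReal_one, ← Complex.ofReal_sub, ← Complex.ofReal_div]
  have hle : ∀ X : Conf E, (Conf.count B X : ℝ) ≤ ((1 + t) ^ Conf.count B X - 1) / t := by
    intro X
    rw [le_div_iff₀ ht.1]
    have := one_add_mul_le_pow (show (-2 : ℝ) ≤ t by linarith [ht.1]) (Conf.count B X)
    linarith
  have hintQ : Integrable (fun X => ((1 + t) ^ Conf.count B X - 1) / t) (P : Measure (Conf E)) :=
    (hintR.sub (integrable_const _)).div_const t
  rw [Function.comp_apply, hdt, ofReal_integral_eq_lintegral_ofReal hintQ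
    (ae_of_all _ fun X => (Nat.cast_nonneg _).trans (hle X))]
  refine lintegral_mono fun X => ?_
  rw [← ENNReal.ofReal_natCast]
  exact ENNReal.ofReal_le_ofReal (hle X)

variable [BorelSpace E]

/-- The left side is the intensity measure A ↦ E #_A; bounded sets exhaust every Borel set. -/
theorem bind_pointMeasure_le_traceMeasure (hK : K.IsPositive) (hP : IsDeterminantal μ K P) :
    (P : Measure (Conf E)).bind pointMeasure ≤ traceMeasure K := by
  refine Measure.le_iff.2 fun A hA => ?_
  obtain ⟨B, hmono, hb, hm, rfl⟩ := exists_monotone_bounded_iUnion_eq hA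
  rw [hmono.measure_iUnion]
  refine iSup_le fun n => ?_
  rw [Measure.bind_apply (hm n) measurable_pointMeasure.aemeasurable]
  simp only [pointMeasure_apply (hb n) (hm n)]
  exact (lintegral_count_le_traceMeasure hK hP (hb n) (hm n)).trans
    (measure_mono (subset_iUnion B n))

/-- The expected mass given to `A` by `∑_{x ∈ X} f(x) δ_x`. -/
theorem lintegral_weightedSum_le (hK : K.IsPositive) (hP : IsDeterminantal μ K P) {f : E → ℝ}
    (hf : Measurable f) {A : Set E} (hA : MeasurableSet A) :
    ∫⁻ X, weightedSum f X A ∂(P : Measure (Conf E)) ≤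
      ∫⁻ x in A, ENNReal.ofReal (f x) ∂(traceMeasure K) := by
  simp only [weightedSum_eq_withDensity hf, withDensity_apply _ hA, ← lintegral_indicator hA]
  rw [← Measure.lintegral_bind measurable_pointMeasure.aemeasurable
    (hf.ennreal_ofReal.indicator hA).aemeasurable]
  exact lintegral_mono' (bind_pointMeasure_le_traceMeasure hK hP) le_rfl

end Intensity

/-! ### Compact sets of finite measures -/

section Compactness

variable {E : Type u} [MeasurableSpace E]

/-- The finite measures `η` with `η E ≤ 2ⁿ` and `η (L k)ᶜ ≤ 2ⁿ 2⁻ᵏ` for all `k`. -/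
def boundedTailSet (L : ℕ → Set E) (n : ℕ) : Set (FiniteMeasure E) :=
  {η | η.mass ≤ 2 ^ n ∧ ∀ k, η (L k)ᶜ ≤ 2 ^ n * (1 / 2) ^ k}

/-- Needed for the second use of the compactness criterion, where the compact sets are taken
increasing. -/
theorem monotone_boundedTailSet (L : ℕ → Set E) : Monotone (boundedTailSet L) := by
  intro m n h η hη
  have h2 : (2 : ℝ≥0) ^ m ≤ 2 ^ n := pow_le_pow_right₀ one_le_two h
  exact ⟨hη.1.trans h2, fun k => (hη.2 k).trans (by gcongr)⟩

variable [MetricSpace E] [BorelSpace E]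

/-- Prokhorov's criterion on `E`: for fixed n the tail bounds tend to 0 in k. -/
theorem isCompact_boundedTailSet {L : ℕ → Set E} (hL : ∀ k, IsCompact (L k)) (n : ℕ) :
    IsCompact (boundedTailSet L n) := by
  refine isCompact_setOfPred_finiteMeasure_mass_le_compl_isCompact_le _ ?_ hL
    (Or.inl inferInstance)
  simpa using (NNReal.tendsto_pow_atTop_nhds_zero_of_lt_one
    (show (1 / 2 : ℝ≥0) < 1 by norm_num)).const_mul (2 ^ n)

/-- Markov's inequality gives M 2⁻ⁿ for the total mass and 4⁻ᵏ/(2ⁿ2⁻ᵏ) = 2⁻ⁿ2⁻ᵏ for the k-th tail.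
The latter sum to 2·2⁻ⁿ, whence M + 2; the rate 4⁻ᵏ is chosen to beat the threshold 2⁻ᵏ summably. -/
theorem measure_sigmaF_notMem_le {f : E → ℝ} (hf : Measurable f)
    {L : ℕ → Set E} (hL : ∀ k, MeasurableSet (L k)) {Q : Measure (Conf E)} {M : ℝ≥0}
    (hM : ∫⁻ X, weightedSum f X univ ∂Q ≤ M)
    (htail : ∀ k, ∫⁻ X, weightedSum f X (L k)ᶜ ∂Q ≤ (1 / 4) ^ k) (n : ℕ) :
    Q {X | sigmaF f X ∉ boundedTailSet L n} ≤ (M + 2) * (1 / 2) ^ n := by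
  have hsub : {X : Conf E | sigmaF f X ∉ boundedTailSet L n} ⊆
      {X | (2 : ℝ≥0∞) ^ n ≤ weightedSum f X univ} ∪
        ⋃ k, {X | (2 : ℝ≥0∞) ^ n * (1 / 2) ^ k ≤ weightedSum f X (L k)ᶜ} := by
    intro X hX
    by_contra hc
    simp only [mem_union, mem_iUnion, mem_ofPred_eq, not_or, not_exists, not_le] at hc
    refine hX ⟨?_, fun k => ?_⟩
    · rw [← ENNReal.coe_le_coe, FiniteMeasure.ennreal_mass]
      exact (sigmaF_apply_le f X univ).trans (by simpa using hc.1.le)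
    · rw [← ENNReal.coe_le_coe, FiniteMeasure.ennreal_coeFn_eq_coeFn_toMeasure]
      exact (sigmaF_apply_le f X _).trans (by simpa [ENNReal.inv_pow] using (hc.2 k).le)
  have hmeas : ∀ A : Set E, MeasurableSet A → Measurable fun X : Conf E => weightedSum f X A :=
    fun A hA => (Measure.measurable_coe hA).comp (measurable_weightedSum hf)
  have h2 : ∀ k : ℕ, (1 / 4 : ℝ≥0∞) ^ k / (2 ^ n * (1 / 2) ^ k) = 2⁻¹ ^ k * 2⁻¹ ^ n := by
    intro k
    have h4 : (1 / 4 : ℝ≥0∞) = 2⁻¹ * 2⁻¹ := by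
      rw [one_div, ← ENNReal.mul_inv (by simp) (by simp)]
      norm_num
    rw [h4, one_div, mul_pow, div_eq_mul_inv, ENNReal.mul_inv (by simp) (by simp),
      ENNReal.inv_pow, ENNReal.inv_pow, inv_inv, mul_comm (2⁻¹ ^ n), mul_assoc (2⁻¹ ^ k),
      ← mul_assoc (2⁻¹ ^ k) (2 ^ k), ← mul_pow, ENNReal.inv_mul_cancel (by simp) (by simp),
      one_pow, one_mul]
  calc Q {X | sigmaF f X ∉ boundedTailSet L n}
      ≤ Q {X | (2 : ℝ≥0∞) ^ n ≤ weightedSum f X univ} +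
        ∑' k, Q {X | (2 : ℝ≥0∞) ^ n * (1 / 2) ^ k ≤ weightedSum f X (L k)ᶜ} :=
        (measure_mono hsub).trans ((measure_union_le _ _).trans
          (add_le_add_right (measure_iUnion_le _) _))
    _ ≤ M / 2 ^ n + ∑' k : ℕ, (1 / 4 : ℝ≥0∞) ^ k / (2 ^ n * (1 / 2) ^ k) := by
        refine add_le_add ?_ (ENNReal.tsum_le_tsum fun k => ?_)
        · exact (meas_ge_le_lintegral_div (hmeas _ .univ).aemeasurable (by simp) (by simp)).trans
            (ENNReal.div_le_div_right hM _)
        · refine (meas_ge_le_lintegral_div (hmeas _ (hL k).compl).aemeasurable (by simp)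
            (ENNReal.mul_ne_top (by simp) (by simp))).trans (ENNReal.div_le_div_right (htail k) _)
    _ = (M + 2) * (1 / 2) ^ n := by
        simp only [h2]
        rw [ENNReal.tsum_mul_right, ENNReal.tsum_geometric, ENNReal.one_sub_inv_two, inv_inv,
          div_eq_mul_inv, ENNReal.inv_pow, one_div, add_mul]

end Compactness

end DetProc

/-! ### Tightness and precompactness of the push-forwards -/

theorem proposition3p6 {E : Type u} [MetricSpace E] [ProperSpace E] [MeasurableSpace E]
    [BorelSpace E] (μ : Measure E) [SigmaFinite μ]
    (f : E → ℝ) (hf_cont : Continuous f) (hf_nonneg : ∀ x, 0 ≤ f x) (hf_bdd : ∃ C, ∀ x, f x ≤ C)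
    {ι : Type*} (K : ι → Lp ℂ 2 μ →L[ℂ] Lp ℂ 2 μ)
    (hK_loc : ∀ a, IsLocallyTraceClass μ (K a))
    (hK_pos : ∀ a, (K a).IsPositive) (hK_contr : ∀ a, ‖K a‖ ≤ 1)
    (P : ι → ProbabilityMeasure (Conf E)) (hP : ∀ a, IsDeterminantal μ (K a) (P a))
    (htr : (⨆ a, posTrace (mulSqrt μ f ∘L K a ∘L mulSqrt μ f)) < ∞)
    (htail : ∀ ε : ℝ, 0 < ε → ∃ B : Set E, IsBounded B ∧ MeasurableSet B ∧
      (⨆ a, posTrace (chi μ Bᶜ ∘L mulSqrt μ f ∘L K a ∘L mulSqrt μ f ∘L chi μ Bᶜ))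
        < ENNReal.ofReal ε) :
    (∀ a, (P a : Measure (Conf E)) (confF f) = 1 ∧
      AEMeasurable (sigmaF f) (P a : Measure (Conf E))) ∧
    IsCompact (closure (range fun a => (P a).toFiniteMeasure.map (sigmaF f))) := by
  obtain ⟨C, hC⟩ := hf_bdd
  have hf := hf_cont.measurable
  set M : ℝ≥0 := (⨆ a, posTrace (mulSqrt μ f ∘L K a ∘L mulSqrt μ f)).toNNReal with hM
  have hmass : ∀ a, ∫⁻ X, weightedSum f X univ ∂(P a : Measure (Conf E)) ≤ M := fun a => by
    refine (lintegral_weightedSum_le (hK_pos a) (hP a) hf .univ).trans ?_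
    rw [Measure.restrict_univ, ← posTrace_mulSqrt (hK_pos a) hf hf_nonneg hC, hM,
      ENNReal.coe_toNNReal htr.ne]
    exact le_iSup (fun a => posTrace (mulSqrt μ f ∘L K a ∘L mulSqrt μ f)) a
  refine ⟨fun a => ⟨?_, (measurable_sigmaF hf).aemeasurable⟩, ?_⟩
  · rw [prob_compl_eq_zero_iff (measurableSet_confF hf) |>.symm]
    have hae := ae_lt_top ((Measure.measurable_coe .univ).comp (measurable_weightedSum hf))
      ((hmass a).trans_lt ENNReal.coe_lt_top).ne
    refine measure_mono_null (fun X hX => ?_) (ae_iff.1 hae)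
    simpa [confF, weightedSum_univ] using hX
  choose B hBb hBm hB using fun k : ℕ => htail ((1 / 4) ^ k) (by positivity)
  -- Compact because `E` is proper; passing to the closure only shrinks the tails.
  set L : ℕ → Set E := fun k => closure (B k) with hL
  have hLc : ∀ k, IsCompact (L k) := fun k => (hBb k).isCompact_closure
  have hLt : ∀ a k, ∫⁻ X, weightedSum f X (L k)ᶜ ∂(P a : Measure (Conf E)) ≤ (1 / 4) ^ k := by
    intro a k
    refine (lintegral_mono fun X => measure_mono
      (compl_subset_compl.2 (subset_closure (s := B k)))).trans ?_
    refine (lintegral_weightedSum_le (hK_pos a) (hP a) hf (hBm k).compl).trans ?_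
    rw [← posTrace_chi_mulSqrt (hK_pos a) hf hf_nonneg hC (hBm k).compl]
    refine (le_iSup (fun a => posTrace (chi μ (B k)ᶜ ∘L mulSqrt μ f ∘L K a ∘L mulSqrt μ f ∘L
      chi μ (B k)ᶜ)) a).trans ((hB k).le.trans_eq ?_)
    rw [ENNReal.ofReal_pow (by norm_num), ENNReal.ofReal_div_of_pos (by norm_num)]
    simp
  have hu : Tendsto (fun n : ℕ => (M + 2) * (1 / 2 : ℝ≥0) ^ n) atTop (𝓝 0) := by
    simpa using (NNReal.tendsto_pow_atTop_nhds_zero_of_lt_one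
      (show (1 / 2 : ℝ≥0) < 1 by norm_num)).const_mul (M + 2)
  -- Prokhorov's criterion again, now on `FiniteMeasure E`, with mass bound 1 because the
  -- push-forwards come from probability measures.
  refine (isCompact_setOfPred_finiteMeasure_mass_le_compl_isCompact_le 1 hu
    (isCompact_boundedTailSet hLc) (Or.inr (monotone_boundedTailSet L))).closure_of_subset ?_
  rintro _ ⟨a, rfl⟩
  refine ⟨(FiniteMeasure.mass_map_le _ _).trans (by simp), fun n => ?_⟩
  -- Closed sets of finite measures are measurable by `borelSpace_finiteMeasure`, so the
  -- push-forward can be evaluated on the complement.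
  rw [← ENNReal.coe_le_coe, FiniteMeasure.ennreal_coeFn_eq_coeFn_toMeasure,
    FiniteMeasure.toMeasure_map, Measure.map_apply (measurable_sigmaF hf)
      (isCompact_boundedTailSet hLc n).isClosed.measurableSet.compl]
  refine (measure_sigmaF_notMem_le hf (fun k => (hLc k).measurableSet) (hmass a) (hLt a) n).trans_eq ?_
  simp [ENNReal.inv_pow]
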